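/- Let $X$ be a compact Hausdorff space and $A=C(X)$ the $C^*$-algebra of continuous complex-valued functions on $X$. Let $l_2(A)$ be the standard Hilbert $A$-module of all sequences $(a_1,a_2,\dots)$ in $A$ such that $\sum_i a_i^*a_i$ converges in norm, with $\langle a,b\rangle=\sum_i a_i^*b_i$ and $\|a\|=\|\langle a,a\rangle\|^{1/2}$. For a normed $A$-module $M$ let $M'$ be the Banach $A$-module of all bounded $A$-linear maps $M\to A$, with the operator norm, and $M''=(M')'$; $M$ is called $C^*$-reflexive if the canonical map $M\to M''$, $m\mapsto(f\mapsto f(m))$, is a bijection. For an open set $U\subset X$ let $C_0(U)=\{f\in C(X): f=0 \text{ on } X\setminus U\}$. For a sequence $(U_k)_{k\in\mathbb N}$ of open sets let $\prod_k C_0(U_k)$ be the $C^*$-algebra of all bounded sequences $(f_k)$ with $f_k\in C_0(U_k)$, and $\bigoplus_k C_0(U_k)$ the subalgebra of those with $\|f_k\|\to 0$; if the $U_k$ are pairwise disjoint, $\bigoplus_k C_0(U_k)$ is canonically included in $C(X)$ by $(f_k)\mapsto\sum_k f_k$. Then $l_2(C(X))$ is not $C^*$-reflexive if and only if there is a sequence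 $(U_k)_{k\in\mathbb N}$ of pairwise disjoint non-empty open subsets of $X$ such that the canonical inclusion $\bigoplus_k C_0(U_k)\subset C(X)$ extends to an inclusion of $\prod_k C_0(U_k)$ into $C(X)$ as an ideal, that is, to an injective $*$-homomorphism $\prod_k C_0(U_k)\to C(X)$ whose range is an ideal of $C(X)$. -/

import Mathlib

open scoped ComplexOrder ENNReal Topology

noncomputable section

namespace HilbertReflexive

/-! ### The standard Hilbert module `l₂(A)` over a commutative C⋆-algebra `A` -/

section StandardModule

variable {A : Type*} [CommCStarAlgebra A] [PartialOrder A] [StarOrderedRing A]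

open WithCStarModule in
/-- Cauchy-Schwarz inequality for finite families in a commutative C⋆-algebra. -/
theorem norm_sum_star_mul_le (s : Finset ℕ) (a b : ℕ → A) :
    ‖∑ i ∈ s, star (a i) * b i‖ ≤
      √‖∑ i ∈ s, star (a i) * a i‖ * √‖∑ i ∈ s, star (b i) * b i‖ := by
  have h := CStarModule.norm_inner_le (A := A) C⋆ᵐᵒᵈ(A, s → A)
    (x := (WithCStarModule.equiv A (s → A)).symm (fun i => a i))
    (y := (WithCStarModule.equiv A (s → A)).symm (fun i => b i))
  rw [pi_norm, pi_norm, pi_inner] at h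
  simp only [WithCStarModule.inner_def, equiv_symm_pi_apply] at h
  rw [Finset.sum_coe_sort s (fun i => b i * star (a i)),
    Finset.sum_coe_sort s (fun i => a i * star (a i)),
    Finset.sum_coe_sort s (fun i => b i * star (b i))] at h
  simpa only [mul_comm] using h

theorem summable_star_mul {a b : ℕ → A} (ha : Summable fun i => star (a i) * a i)
    (hb : Summable fun i => star (b i) * b i) : Summable fun i => star (a i) * b i := by
  rw [summable_iff_vanishing_norm] at *
  intro ε hε
  obtain ⟨s, hs⟩ := ha ε hε
  obtain ⟨t, ht⟩ := hb ε hε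
  refine ⟨s ∪ t, fun u hu => ?_⟩
  rw [Finset.disjoint_union_right] at hu
  calc _ ≤ _ := norm_sum_star_mul_le u a b
    _ < √ε * √ε := by
      apply mul_lt_mul'' <;> first | positivity | skip
      · exact Real.sqrt_lt_sqrt (norm_nonneg _) (hs u hu.1)
      · exact Real.sqrt_lt_sqrt (norm_nonneg _) (ht u hu.2)
    _ = ε := Real.mul_self_sqrt hε.le

variable (A) in
/-- The sequences `(a₁, a₂, …)` in `A` for which `∑ aᵢ⋆ aᵢ` converges in norm. (The terms are
positive, so convergence of the partial sums and unconditional convergence are the same.) -/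
def l2Submodule : Submodule A (ℕ → A) where
  carrier := {a | Summable fun i => star (a i) * a i}
  zero_mem' := by simp
  add_mem' {a b} ha hb := by
    have h := ((summable_star_mul ha ha).add (summable_star_mul ha hb)).add
      ((summable_star_mul hb ha).add (summable_star_mul hb hb))
    refine h.congr fun i => ?_
    simp only [Pi.add_apply, star_add]
    ring
  smul_mem' c a ha := by
    refine (Summable.mul_left (star c * c) ha).congr fun i => ?_
    simp only [Pi.smul_apply, smul_eq_mul, star_mul']
    ring

variable (A) in
/-- The standard Hilbert `A`-module `l₂(A)`, a type of its own because its norm topology is not the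
topology of pointwise convergence. -/
def L2 : Type _ := l2Submodule A

namespace L2

instance : AddCommGroup (L2 A) := inferInstanceAs (AddCommGroup (l2Submodule A))
instance : Module A (L2 A) := inferInstanceAs (Module A (l2Submodule A))
instance : Module ℂ (L2 A) := inferInstanceAs (Module ℂ (l2Submodule A))
instance : CoeFun (L2 A) fun _ => ℕ → A := ⟨fun a => a.1⟩

theorem summable_inner (a b : L2 A) : Summable fun i => star (a i) * b i :=
  summable_star_mul a.2 b.2

/-- The `A`-valued inner product `⟨a, b⟩ = ∑ aᵢ⋆ bᵢ`. -/
instance : Inner A (L2 A) := ⟨fun a b => ∑' i, star (a i) * b i⟩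

/-- The norm `‖a‖ = ‖⟨a, a⟩‖ ^ (1/2)`. -/
instance : Norm (L2 A) := CStarModule.norm A

instance : CStarModule A (L2 A) where
  inner_add_right {x y z} := by
    refine Eq.trans (tsum_congr fun i => ?_)
      ((summable_inner x y).tsum_add (summable_inner x z))
    exact mul_add _ _ _
  inner_self_nonneg := tsum_nonneg fun _ => star_mul_self_nonneg _
  inner_self {x} := by
    constructor
    · intro h
      have h' := (hasSum_zero_iff_of_nonneg (fun i => star_mul_self_nonneg (x i))).1
        ((summable_inner x x).hasSum_iff.2 h)
      refine Subtype.ext (funext fun i => ?_)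
      exact (CStarRing.star_mul_self_eq_zero_iff _).1 (congrFun h' i)
    · rintro rfl
      refine Eq.trans (tsum_congr fun i => ?_) tsum_zero
      exact mul_zero _
  inner_op_smul_right {a x y} := by
    refine Eq.trans (tsum_congr fun i => ?_) ((summable_inner x y).tsum_mul_left a)
    exact mul_left_comm _ _ _
  inner_smul_right_complex {z x y} := by
    refine Eq.trans (tsum_congr fun i => ?_) ((summable_inner x y).tsum_const_smul z)
    exact mul_smul_comm _ _ _
  star_inner x y := by
    refine Eq.trans (tsum_star (f := fun i => star (x i) * y i)) (tsum_congr fun i => ?_)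
    simp [mul_comm]
  norm_eq_sqrt_norm_inner_self _ := rfl

instance : NormedAddCommGroup (L2 A) := CStarModule.normedAddCommGroup A

instance : NormedSpace ℂ (L2 A) := NormedSpace.ofCore (CStarModule.normedSpaceCore A)

end L2

end StandardModule

/-! ### Dual modules and reflexivity -/

section Dual

variable (A M : Type*) [CommCStarAlgebra A] [NormedAddCommGroup M] [NormedSpace ℂ M] [Module A M]

/-- The bounded `A`-linear maps `M → A`, as an `A`-module under `(a • f)(m) = a * f m`. -/
def dualSubmodule : Submodule A (M →L[ℂ] A) where
  carrier := {f | ∀ (a : A) (m : M), f (a • m) = a * f m}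
  zero_mem' := by simp
  add_mem' {f g} hf hg a m := by simp [hf a m, hg a m, mul_add]
  smul_mem' c f hf a m := by simp [hf a m, mul_left_comm]

/-- The dual Banach module `M'` of bounded `A`-linear maps `M → A`, with the operator norm. -/
abbrev Dual : Type _ := dualSubmodule A M

variable {M} in
/-- The element `f ↦ f m` of the second dual module `M''`. -/
def evalBidual (m : M) : Dual A (Dual A M) :=
  ⟨(ContinuousLinearMap.apply ℂ A m).comp
    ((dualSubmodule A M).subtypeL.restrictScalars ℂ), fun _ _ => rfl⟩

theorem evalBidual_apply (m : M) (f : Dual A M) : (evalBidual A m).1 f = f.1 m := rfl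

/-- `M` is C⋆-reflexive, `M'' = M`: the canonical map `M → M''` is a bijection. -/
def IsCStarReflexive : Prop := Function.Bijective (evalBidual A : M → Dual A (Dual A M))

end Dual

/-! ### Products of the ideals `C₀(U)` -/

section Product

variable {X : Type*} [TopologicalSpace X] [CompactSpace X]

/-- `C₀(U)`, the kernel of the restriction map `C(X) → C(X \ U)`. -/
def C0 (U : Set X) : NonUnitalStarSubalgebra ℂ C(X, ℂ) where
  carrier := {f | ∀ x ∉ U, f x = 0}
  zero_mem' := by simp
  add_mem' {f g} hf hg x hx := by simp [hf x hx, hg x hx]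
  mul_mem' {f g} hf hg x hx := by simp [hf x hx]
  smul_mem' c f hf x hx := by simp [hf x hx]
  star_mem' {f} hf x hx := by simp [hf x hx]

instance (U : Set X) : NormedStarGroup (C0 U) := ⟨fun f => (norm_star (f : C(X, ℂ))).le⟩

/-- The C⋆-algebra `∏ₖ C₀(Uₖ)` of bounded sequences, with the supremum norm. -/
abbrev C0Prod (U : ℕ → Set X) : Type _ := lp (fun k => C0 (U k)) ∞

/-- The canonical inclusion of `⊕ₖ C₀(Uₖ)`, `(aₖ) ↦ ∑ₖ aₖ`, where `‖aₖ‖ → 0`, extends to an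
inclusion of `∏ₖ C₀(Uₖ)` into `C(X)` as an ideal. -/
def ProdIncludesCanonically (U : ℕ → Set X) : Prop :=
  ∃ φ : C0Prod U →⋆ₙₐ[ℂ] C(X, ℂ),
    Function.Injective φ ∧
    (∀ a : C0Prod U, Filter.Tendsto (fun k => ‖a k‖) Filter.atTop (𝓝 0) →
      HasSum (fun k => (a k : C(X, ℂ))) (φ a)) ∧
    ∃ I : Ideal C(X, ℂ), (I : Set C(X, ℂ)) = Set.range φ

end Product

end HilbertReflexive

end

/-!
A bounded `A`-linear functional `f` on `l₂(A)`, `A = C(X)`, is the same as its sequence of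
coefficients `f eₖ`: the partial sums of `∑ |f eₖ|²` are bounded, and every sequence with this
property occurs (`Dual.norm_sum_coeff_le`, `Dual.ofCoeff`). Such a sequence is a vector of `l₂(A)` only
if `∑ |f eₖ|²` converges uniformly. By the Baire category theorem, however, its tails are locally
uniformly small on a dense open set (`dense_iUnion_interior_smallTail`). Hence an element `F` of the
second dual is determined by its values `bₖ` at the coordinate functionals
(`bidual_eq_zero_of_coord`), and it comes from a vector if and only if `∑ |bₖ|²` converges uniformly;
the partial sums of `∑ |bₖ|²` are bounded in any case.

On the topological side, for disjoint open sets `Uₖ` a canonical inclusion of `∏ₖ C₀(Uₖ)` as an ideal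
exists if and only if every bounded sequence `gₖ ∈ C₀(Uₖ)` has a gluing: a continuous function that
equals `gₖ` on `Uₖ` and vanishes off the closure of `⋃ Uₖ`. Two such functions agree on a dense set,
so gluings are unique; the algebraic properties of the inclusion all follow from this
(`HasGluings.prodIncludesCanonically`, `ProdIncludesCanonically.hasGluings`).

If gluings exist, choose `uₖ ∈ C₀(Uₖ)` of norm one. Gluing `(uₖ f(eₖ))ₖ` defines a functional of `f`
whose coordinates `uₖ` do not tend to zero, so `l₂(A)` is not reflexive
(`not_isCStarReflexive_of_hasGluings`). Conversely, if `F` does not come from a vector, there are finite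
blocks `tₙ` of indices, arbitrarily far out, for which `∑ k ∈ tₙ, |bₖ|²` exceeds some `δ > 0` on a
non-empty open set. Because tails are small on a dense open set, these open sets can be shrunk so
that, along a subsequence, they are disjoint (`exists_disjoint_blocks`). A bounded sequence
`gₙ ∈ C₀(Uₙ)` is then glued by evaluating `F` at the functional with coefficients
`star bₖ * gₙ / ∑ l ∈ tₙ, |b_l|²`, `k ∈ tₙ` (`hasGluings_of_blocks`).
-/

noncomputable section

namespace HilbertReflexive

/-! ### Coefficients of bounded `A`-linear functionals on `l₂(A)` -/

theorem Dual.map_smul {A M : Type*} [CommCStarAlgebra A] [NormedAddCommGroup M] [NormedSpace ℂ M]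
    [Module A M] (f : Dual A M) (a : A) (m : M) : f.1 (a • m) = a * f.1 m := f.2 a m

section Coefficients

variable {A : Type*} [CommCStarAlgebra A] [PartialOrder A] [StarOrderedRing A]

theorem le_sq_of_le_mul_sqrt {S N : ℝ} (hS : 0 ≤ S) (h : S ≤ N * √S) : S ≤ N ^ 2 := by
  rcases hS.eq_or_lt with rfl | hS'
  · positivity
  · have h₁ : √S * √S ≤ N * √S := by rwa [Real.mul_self_sqrt hS]
    have h₂ : √S ≤ N := le_of_mul_le_mul_right h₁ (Real.sqrt_pos.2 hS')
    calc S = √S ^ 2 := (Real.sq_sqrt hS).symm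
      _ ≤ N ^ 2 := by gcongr

theorem norm_sum_star_mul_self_mono {s t : Finset ℕ} (h : s ⊆ t) (a : ℕ → A) :
    ‖∑ i ∈ s, star (a i) * a i‖ ≤ ‖∑ i ∈ t, star (a i) * a i‖ :=
  CStarAlgebra.norm_le_norm_of_nonneg_of_le (Finset.sum_nonneg fun _ _ => star_mul_self_nonneg _)
    (Finset.sum_le_sum_of_subset_of_nonneg h fun _ _ _ => star_mul_self_nonneg _)

/-- Cauchy-Schwarz for finite families, without the involution on the left-hand side. -/
theorem norm_sum_mul_le (s : Finset ℕ) (a b : ℕ → A) :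
    ‖∑ i ∈ s, a i * b i‖ ≤
      √‖∑ i ∈ s, star (a i) * a i‖ * √‖∑ i ∈ s, star (b i) * b i‖ := by
  simpa only [star_star, mul_comm] using norm_sum_star_mul_le s (fun i => star (a i)) b

namespace L2

theorem norm_eq (m : L2 A) : ‖m‖ = √‖∑' i, star (m i) * m i‖ := rfl

theorem sqrt_norm_sum_le (m : L2 A) (s : Finset ℕ) :
    √‖∑ i ∈ s, star (m i) * m i‖ ≤ ‖m‖ := by
  rw [norm_eq]
  refine Real.sqrt_le_sqrt (CStarAlgebra.norm_le_norm_of_nonneg_of_le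
    (Finset.sum_nonneg fun _ _ => star_mul_self_nonneg _) ?_)
  exact (summable_inner m m).sum_le_tsum s fun _ _ => star_mul_self_nonneg _

@[simp] theorem smul_apply (a : A) (m : L2 A) (i : ℕ) : (a • m) i = a * m i := rfl
@[simp] theorem add_apply (m n : L2 A) (i : ℕ) : (m + n) i = m i + n i := rfl
@[simp] theorem sub_apply (m n : L2 A) (i : ℕ) : (m - n) i = m i - n i := rfl

@[simp] theorem sum_apply {ι : Type*} (s : Finset ι) (m : ι → L2 A) (i : ℕ) :
    (∑ k ∈ s, m k) i = ∑ k ∈ s, m k i := by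
  classical
  induction s using Finset.induction_on with
  | empty => rfl
  | insert k s hk ih => rw [Finset.sum_insert hk, Finset.sum_insert hk, add_apply, ih]

variable (A) in
/-- The standard basis vector `eₖ` of `l₂(A)`. -/
def basisVec (k : ℕ) : L2 A :=
  ⟨Pi.single k 1, (hasSum_single k fun i hi => by simp [Pi.single_eq_of_ne hi]).summable⟩

theorem basisVec_apply (k i : ℕ) : basisVec A k i = if i = k then 1 else 0 :=
  Pi.single_apply k 1 i

theorem sum_smul_basisVec_apply (s : Finset ℕ) (a : ℕ → A) (i : ℕ) :
    (∑ k ∈ s, a k • basisVec A k) i = if i ∈ s then a i else 0 := by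
  simp [basisVec_apply]

theorem norm_sum_smul_basisVec (s : Finset ℕ) (a : ℕ → A) :
    ‖∑ k ∈ s, a k • basisVec A k‖ = √‖∑ k ∈ s, star (a k) * a k‖ := by
  have h (i : ℕ) := sum_smul_basisVec_apply s a i
  rw [norm_eq, tsum_eq_sum (s := s)]
  · congr 2
    exact Finset.sum_congr rfl fun i hi => by simp only [h, if_pos hi]
  · intro i hi
    simp only [h, if_neg hi, mul_zero]

theorem norm_le_of_sum_le {m : L2 A} {C : ℝ} (hC : 0 ≤ C)
    (h : ∀ s : Finset ℕ, ‖∑ i ∈ s, star (m i) * m i‖ ≤ C ^ 2) : ‖m‖ ≤ C := by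
  rw [norm_eq]
  exact Real.sqrt_le_iff.2 ⟨hC, le_of_tendsto (summable_inner m m).hasSum.norm (.of_forall h)⟩

theorem hasSum_smul_basisVec (m : L2 A) : HasSum (fun k => m k • basisVec A k) m := by
  rw [HasSum, SummationFilter.unconditional_filter, Metric.tendsto_nhds]
  intro ε hε
  obtain ⟨s, hs⟩ := summable_iff_vanishing_norm.1 (summable_inner m m) ((ε / 2) ^ 2) (by positivity)
  filter_upwards [Filter.eventually_ge_atTop s] with t hst
  rw [dist_eq_norm]
  refine (norm_le_of_sum_le (half_pos hε).le fun u => ?_).trans_lt (half_lt_self hε)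
  have h (i : ℕ) : star ((∑ k ∈ t, m k • basisVec A k - m) i) *
      (∑ k ∈ t, m k • basisVec A k - m) i = if i ∉ t then star (m i) * m i else 0 := by
    simp only [sub_apply, sum_smul_basisVec_apply]
    split_ifs <;> simp
  simp only [h, ← Finset.sum_filter]
  refine (hs _ (Finset.disjoint_left.2 fun i hi his => ?_)).le
  exact (Finset.mem_filter.1 hi).2 (hst his)

theorem ext_apply {m n : L2 A} (h : ∀ i, m i = n i) : m = n := Subtype.ext (funext h)

end L2

namespace Dual

/-- The coefficients `f eₖ` of a bounded `A`-linear functional `f` on `l₂(A)`. -/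
def coeff (f : Dual A (L2 A)) (k : ℕ) : A := f.1 (L2.basisVec A k)

theorem hasSum_coeff_mul (f : Dual A (L2 A)) (m : L2 A) :
    HasSum (fun k => f.coeff k * m k) (f.1 m) := by
  have h : (fun k => f.coeff k * m k) = fun k => f.1 (m k • L2.basisVec A k) :=
    funext fun k => (mul_comm _ _).trans (f.2 (m k) _).symm
  rw [h]
  exact (L2.hasSum_smul_basisVec m).mapL f.1

theorem ext_coeff {f g : Dual A (L2 A)} (h : ∀ k, f.coeff k = g.coeff k) : f = g := by
  refine Subtype.ext (ContinuousLinearMap.ext fun m => (f.hasSum_coeff_mul m).unique ?_)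
  simpa only [h] using g.hasSum_coeff_mul m

@[simp] theorem coeff_add (f g : Dual A (L2 A)) (k : ℕ) :
    (f + g).coeff k = f.coeff k + g.coeff k := rfl
@[simp] theorem coeff_sub (f g : Dual A (L2 A)) (k : ℕ) :
    (f - g).coeff k = f.coeff k - g.coeff k := rfl
@[simp] theorem coeff_smul (a : A) (f : Dual A (L2 A)) (k : ℕ) :
    (a • f).coeff k = a * f.coeff k := rfl
@[simp] theorem coeff_sum {ι : Type*} (s : Finset ι) (f : ι → Dual A (L2 A)) (k : ℕ) :
    (∑ i ∈ s, f i).coeff k = ∑ i ∈ s, (f i).coeff k := by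
  classical
  induction s using Finset.induction_on with
  | empty => rfl
  | insert i s hi ih => rw [Finset.sum_insert hi, Finset.sum_insert hi, coeff_add, ih]

/-- The squared coefficients of a functional have bounded partial sums: evaluate the functional at
`∑ k ∈ s, f(eₖ)⋆ eₖ`. -/
theorem norm_sum_coeff_le (f : Dual A (L2 A)) (s : Finset ℕ) :
    ‖∑ k ∈ s, star (f.coeff k) * f.coeff k‖ ≤ ‖f‖ ^ 2 := by
  have h := f.1.le_opNorm (∑ k ∈ s, star (f.coeff k) • L2.basisVec A k)
  rw [L2.norm_sum_smul_basisVec, map_sum, Finset.sum_congr rfl fun k _ => f.map_smul _ _] at h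
  simp only [star_star, mul_comm (f.coeff _)] at h
  exact le_sq_of_le_mul_sqrt (norm_nonneg _) h

theorem norm_le_of_sum_coeff_le {f : Dual A (L2 A)} {C : ℝ} (hC : 0 ≤ C)
    (h : ∀ s : Finset ℕ, ‖∑ k ∈ s, star (f.coeff k) * f.coeff k‖ ≤ C ^ 2) : ‖f‖ ≤ C := by
  refine f.1.opNorm_le_bound hC fun m => le_of_tendsto (f.hasSum_coeff_mul m).norm
    (.of_forall fun s => (norm_sum_mul_le s _ _).trans ?_)
  exact mul_le_mul (Real.sqrt_le_iff.2 ⟨hC, h s⟩) (m.sqrt_norm_sum_le s) (Real.sqrt_nonneg _) hC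

theorem summable_mul_of_sum_le {c : ℕ → A} {C : ℝ}
    (h : ∀ s : Finset ℕ, ‖∑ k ∈ s, star (c k) * c k‖ ≤ C ^ 2) (m : L2 A) :
    Summable fun k => c k * m k := by
  rw [summable_iff_vanishing_norm]
  intro ε hε
  obtain ⟨s, hs⟩ := summable_iff_vanishing_norm.1 (L2.summable_inner m m)
    ((ε / (|C| + 1)) ^ 2) (by positivity)
  refine ⟨s, fun t ht => (norm_sum_mul_le t _ _).trans_lt ?_⟩
  have h₁ : √‖∑ k ∈ t, star (c k) * c k‖ ≤ |C| :=
    Real.sqrt_le_iff.2 ⟨abs_nonneg C, (h t).trans_eq (sq_abs C).symm⟩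
  have h₂ : √‖∑ k ∈ t, star (m k) * m k‖ < ε / (|C| + 1) :=
    (Real.sqrt_lt' (by positivity)).2 (hs t ht)
  calc _ ≤ |C| * (ε / (|C| + 1)) := by gcongr
    _ < (|C| + 1) * (ε / (|C| + 1)) := by gcongr; linarith
    _ = ε := by field_simp

/-- The functional `m ↦ ∑ cₖ mₖ` given by a sequence whose squares have bounded partial sums; the
sum need not converge. -/
def ofCoeff (c : ℕ → A) (C : ℝ) (hC : 0 ≤ C)
    (h : ∀ s : Finset ℕ, ‖∑ k ∈ s, star (c k) * c k‖ ≤ C ^ 2) : Dual A (L2 A) :=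
  ⟨LinearMap.mkContinuous
    { toFun m := ∑' k, c k * m k
      map_add' m n := by
        rw [← (summable_mul_of_sum_le h m).tsum_add (summable_mul_of_sum_le h n)]
        exact tsum_congr fun k => mul_add _ _ _
      map_smul' z m := by
        refine Eq.trans (tsum_congr fun k => ?_) ((summable_mul_of_sum_le h m).tsum_const_smul z)
        exact mul_smul_comm _ _ _ } C fun m =>
      le_of_tendsto (summable_mul_of_sum_le h m).hasSum.norm
        (.of_forall fun s => (norm_sum_mul_le s _ _).trans
          (mul_le_mul (Real.sqrt_le_iff.2 ⟨hC, h s⟩) (m.sqrt_norm_sum_le s)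
            (Real.sqrt_nonneg _) hC)),
    fun a m => Eq.trans (tsum_congr fun k => mul_left_comm _ _ _)
      ((summable_mul_of_sum_le h m).tsum_mul_left a)⟩

theorem coeff_ofCoeff (c : ℕ → A) (C : ℝ) (hC : 0 ≤ C)
    (h : ∀ s : Finset ℕ, ‖∑ k ∈ s, star (c k) * c k‖ ≤ C ^ 2) (k : ℕ) :
    (ofCoeff c C hC h).coeff k = c k := by
  refine (tsum_eq_single k fun i hi => ?_).trans ?_
  · rw [L2.basisVec_apply, if_neg hi, mul_zero]
  · rw [L2.basisVec_apply, if_pos rfl, mul_one]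

variable (A) in
/-- The coordinate functional `m ↦ mₖ`. -/
def coord (k : ℕ) : Dual A (L2 A) :=
  ofCoeff (Pi.single k 1) 1 zero_le_one fun s => by
    have h : ∀ i, star ((Pi.single k 1 : ℕ → A) i) * (Pi.single k 1 : ℕ → A) i =
        if i = k then 1 else 0 := fun i => by
      rw [Pi.single_apply]; split_ifs <;> simp
    simp only [h, Finset.sum_ite_eq']
    split_ifs
    · nontriviality A
      simp
    · simp

theorem coord_apply (k : ℕ) (m : L2 A) : (coord A k).1 m = m k := by
  refine (tsum_eq_single k fun i hi => ?_).trans ?_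
  · rw [Pi.single_eq_of_ne hi, zero_mul]
  · rw [Pi.single_eq_same, one_mul]

theorem coeff_coord (k i : ℕ) : (coord A k).coeff i = if i = k then 1 else 0 :=
  (coeff_ofCoeff _ _ _ _ i).trans (Pi.single_apply k 1 i)

theorem coeff_sum_smul_coord (s : Finset ℕ) (a : ℕ → A) (i : ℕ) :
    (∑ k ∈ s, a k • coord A k).coeff i = if i ∈ s then a i else 0 := by
  simp [coeff_coord]

end Dual

/-- The images of the coordinate functionals under an element of the second dual module have
squares with bounded partial sums. -/
theorem norm_sum_bidual_coord_le (F : Dual A (Dual A (L2 A))) (s : Finset ℕ) :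
    ‖∑ k ∈ s, star (F.1 (Dual.coord A k)) * F.1 (Dual.coord A k)‖ ≤ ‖F‖ ^ 2 := by
  set b := fun k => F.1 (Dual.coord A k)
  have h := F.1.le_opNorm (∑ k ∈ s, star (b k) • Dual.coord A k)
  rw [map_sum, Finset.sum_congr rfl fun k _ => Dual.map_smul F _ _] at h
  refine le_sq_of_le_mul_sqrt (norm_nonneg _)
    (h.trans (mul_le_mul_of_nonneg_left ?_ (norm_nonneg _)))
  refine Dual.norm_le_of_sum_coeff_le (Real.sqrt_nonneg _) fun t => ?_
  have h' (i : ℕ) : star ((∑ k ∈ s, star (b k) • Dual.coord A k).coeff i) *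
      (∑ k ∈ s, star (b k) • Dual.coord A k).coeff i =
      if i ∈ s then star (b i) * b i else 0 := by
    rw [Dual.coeff_sum_smul_coord]
    split_ifs <;> simp [mul_comm]
  simp only [h', ← Finset.sum_filter]
  rw [Real.sq_sqrt (norm_nonneg _)]
  exact norm_sum_star_mul_self_mono (fun i hi => (Finset.mem_filter.1 hi).2) b

end Coefficients
/-! ### Gluing bounded sequences over disjoint open sets -/

section Gluing

variable {X : Type*} [TopologicalSpace X]

/-- `c` glues the sequence `g` over the sets `U k`: it equals `g k` on `U k` and vanishes off the
closure of their union. -/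
structure IsGluing (U : ℕ → Set X) (g : ℕ → C(X, ℂ)) (c : C(X, ℂ)) : Prop where
  eq_on : ∀ k, ∀ x ∈ U k, c x = g k x
  eq_zero : ∀ x ∉ closure (⋃ k, U k), c x = 0

/-- Every bounded sequence of functions `g k ∈ C₀(U k)` can be glued to a continuous function. -/
def HasGluings [CompactSpace X]  (U : ℕ → Set X) : Prop :=
  ∀ (g : ℕ → C(X, ℂ)) (R : ℝ), (∀ k, g k ∈ C0 (U k)) → (∀ k, ‖g k‖ ≤ R) → ∃ c, IsGluing U g c

theorem dense_union_compl_closure {X : Type*} [TopologicalSpace X] (S : Set X) :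
    Dense (S ∪ (closure S)ᶜ) := by
  intro x
  rw [closure_union]
  by_cases hx : x ∈ closure S
  · exact .inl hx
  · exact .inr (subset_closure hx)

namespace IsGluing

variable {U : ℕ → Set X} {g h : ℕ → C(X, ℂ)} {c d : C(X, ℂ)}

theorem unique (hc : IsGluing U g c) (hd : IsGluing U g d) : c = d := by
  refine ContinuousMap.ext fun x => congrFun (Continuous.ext_on
    (dense_union_compl_closure (⋃ k, U k)) c.continuous d.continuous ?_) x
  rintro x (hx | hx)
  · obtain ⟨k, hk⟩ := Set.mem_iUnion.1 hx
    rw [hc.eq_on k x hk, hd.eq_on k x hk]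
  · rw [hc.eq_zero x hx, hd.eq_zero x hx]

theorem norm_le [CompactSpace X] {R : ℝ} (hR : 0 ≤ R) (hc : IsGluing U g c)
    (hg : ∀ k, ‖g k‖ ≤ R) : ‖c‖ ≤ R := by
  refine (ContinuousMap.norm_le c hR).2 fun x => ?_
  have hcl : IsClosed {x | ‖c x‖ ≤ R} := isClosed_le (by fun_prop) continuous_const
  refine hcl.closure_subset_iff.2 ?_ (dense_union_compl_closure (⋃ k, U k) x)
  rintro y (hy | hy)
  · obtain ⟨k, hk⟩ := Set.mem_iUnion.1 hy
    exact (congrArg norm (hc.eq_on k y hk)).trans_le (((g k).norm_coe_le_norm y).trans (hg k))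
  · simpa [hc.eq_zero y hy] using hR

theorem add (hc : IsGluing U g c) (hd : IsGluing U h d) :
    IsGluing U (fun k => g k + h k) (c + d) where
  eq_on k x hx := by simp [hc.eq_on k x hx, hd.eq_on k x hx]
  eq_zero x hx := by simp [hc.eq_zero x hx, hd.eq_zero x hx]

theorem sub (hc : IsGluing U g c) (hd : IsGluing U h d) :
    IsGluing U (fun k => g k - h k) (c - d) where
  eq_on k x hx := by simp [hc.eq_on k x hx, hd.eq_on k x hx]
  eq_zero x hx := by simp [hc.eq_zero x hx, hd.eq_zero x hx]

theorem mul (hc : IsGluing U g c) (hd : IsGluing U h d) :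
    IsGluing U (fun k => g k * h k) (c * d) where
  eq_on k x hx := by simp [hc.eq_on k x hx, hd.eq_on k x hx]
  eq_zero x hx := by simp [hc.eq_zero x hx]

theorem const_mul (a : C(X, ℂ)) (hc : IsGluing U g c) :
    IsGluing U (fun k => a * g k) (a * c) where
  eq_on k x hx := by simp [hc.eq_on k x hx]
  eq_zero x hx := by simp [hc.eq_zero x hx]

theorem const_smul (z : ℂ) (hc : IsGluing U g c) :
    IsGluing U (fun k => z • g k) (z • c) where
  eq_on k x hx := by simp [hc.eq_on k x hx]
  eq_zero x hx := by simp [hc.eq_zero x hx]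

theorem star (hc : IsGluing U g c) : IsGluing U (fun k => star (g k)) (star c) where
  eq_on k x hx := by simp [hc.eq_on k x hx]
  eq_zero x hx := by simp [hc.eq_zero x hx]

theorem zero : IsGluing U 0 0 where
  eq_on _ _ _ := rfl
  eq_zero _ _ := rfl

/-- A finite sum glues its terms. -/
theorem sum (hU : Pairwise fun j k => Disjoint (U j) (U k)) (hg : ∀ k, g k ∈ C0 (U k))
    (s : Finset ℕ) : IsGluing U (fun k => if k ∈ s then g k else 0) (∑ k ∈ s, g k) where
  eq_on k x hx := by
    have h (i : ℕ) (hi : i ≠ k) : g i x = 0 :=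
      hg i x fun hx' => Set.disjoint_left.1 (hU hi) hx' hx
    rw [ContinuousMap.sum_apply]
    split_ifs with hk
    · exact Finset.sum_eq_single_of_mem k hk fun i _ hi => h i hi
    · exact Finset.sum_eq_zero fun i hi => h i fun hik => hk (hik ▸ hi)
  eq_zero x hx := by
    rw [ContinuousMap.sum_apply]
    exact Finset.sum_eq_zero fun i _ => hg i x fun hx' =>
      hx (subset_closure (Set.mem_iUnion_of_mem i hx'))

end IsGluing

variable [CompactSpace X] {U : ℕ → Set X}

theorem C0Prod.coe_mem (a : C0Prod U) (k : ℕ) : (a k : C(X, ℂ)) ∈ C0 (U k) := (a k).2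

theorem C0Prod.norm_coe_le (a : C0Prod U) (k : ℕ) : ‖(a k : C(X, ℂ))‖ ≤ ‖a‖ :=
  lp.norm_apply_le_norm ENNReal.top_ne_zero a k

/-- The element of `∏ₖ C₀(Uₖ)` with given bounded components. -/
def C0Prod.mk (g : ℕ → C(X, ℂ)) (R : ℝ) (hg : ∀ k, g k ∈ C0 (U k)) (hR : ∀ k, ‖g k‖ ≤ R) :
    C0Prod U :=
  ⟨fun k => ⟨g k, hg k⟩, memℓp_infty ⟨R, Set.forall_mem_range.2 hR⟩⟩

theorem C0Prod.ext {a b : C0Prod U} (h : ∀ k, ∀ x ∈ U k, (a k : C(X, ℂ)) x = (b k : C(X, ℂ)) x) :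
    a = b := by
  refine lp.ext (funext fun k => Subtype.ext (ContinuousMap.ext fun x => ?_))
  by_cases hx : x ∈ U k
  · exact h k x hx
  · rw [a.coe_mem k x hx, b.coe_mem k x hx]

/-- Gluing is an injective ⋆-homomorphism on `∏ₖ C₀(Uₖ)`, and its range is an ideal. -/
theorem HasGluings.prodIncludesCanonically (hU : Pairwise fun j k => Disjoint (U j) (U k))
    (H : HasGluings U) : ProdIncludesCanonically U := by
  choose c hc using fun a : C0Prod U => H (fun k => a k) ‖a‖ a.coe_mem a.norm_coe_le
  have huniq {a : C0Prod U} {g : ℕ → C(X, ℂ)} {d : C(X, ℂ)} (h : IsGluing U g d)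
      (hg : ∀ k, (a k : C(X, ℂ)) = g k) : c a = d := by
    have := hc a
    simp only [hg] at this
    exact this.unique h
  let φ : C0Prod U →⋆ₙₐ[ℂ] C(X, ℂ) :=
    { toFun := c
      map_smul' z a := huniq ((hc a).const_smul z) fun k => rfl
      map_zero' := huniq .zero fun k => rfl
      map_add' a b := huniq ((hc a).add (hc b)) fun k => rfl
      map_mul' a b := huniq ((hc a).mul (hc b)) fun k => rfl
      map_star' a := huniq (hc a).star fun k => rfl }
  refine ⟨φ, fun a b hab => C0Prod.ext fun k x hx => ?_, fun a ha => ?_, ?_⟩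
  · rw [← (hc a).eq_on k x hx, ← (hc b).eq_on k x hx]
    exact congrArg (· x) hab
  · rw [HasSum, SummationFilter.unconditional_filter, Metric.tendsto_nhds]
    intro ε hε
    obtain ⟨N, hN⟩ := Metric.tendsto_atTop.1 ha (ε / 2) (half_pos hε)
    filter_upwards [Filter.eventually_ge_atTop (Finset.range N)] with s hs
    rw [dist_eq_norm]
    refine (((IsGluing.sum hU a.coe_mem s).sub (hc a)).norm_le (half_pos hε).le
      fun k => ?_).trans_lt (half_lt_self hε)
    split_ifs with hk
    · simpa using (half_pos hε).le
    · have hNk : N ≤ k := not_lt.1 fun h => hk (hs (Finset.mem_range.2 h))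
      have := (hN k hNk).le
      rw [dist_zero_right, norm_norm] at this
      simpa using this
  · refine ⟨⟨⟨⟨Set.range φ, ?_⟩, ?_⟩, ?_⟩, rfl⟩
    · rintro _ _ ⟨a, rfl⟩ ⟨b, rfl⟩
      exact ⟨a + b, map_add φ a b⟩
    · exact ⟨0, map_zero φ⟩
    · rintro b _ ⟨a, rfl⟩
      have hR (k : ℕ) : ‖b * (a k : C(X, ℂ))‖ ≤ ‖b‖ * ‖a‖ :=
        (norm_mul_le _ _).trans (by gcongr; exact a.norm_coe_le k)
      have hb (k : ℕ) : b * (a k : C(X, ℂ)) ∈ C0 (U k) := fun x hx => by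
        simp [a.coe_mem k x hx]
      exact ⟨C0Prod.mk _ _ hb hR, huniq ((hc a).const_mul b) fun k => rfl⟩

variable [T2Space X]

theorem exists_bump {V : Set X} (hV : IsOpen V) {x : X} (hx : x ∈ V) :
    ∃ a : C(X, ℂ), a x = 1 ∧ (∀ y, ‖a y‖ ≤ 1) ∧ ∀ y ∉ V, a y = 0 := by
  obtain ⟨f, hf₀, hf₁, hf⟩ := exists_continuous_zero_one_of_isClosed hV.isClosed_compl
    (isClosed_singleton (x := x)) (Set.disjoint_singleton_right.2 fun h => h hx)
  refine ⟨⟨fun y => (f y : ℂ), by fun_prop⟩, ?_, fun y => ?_, fun y hy => ?_⟩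
  · simpa using hf₁ rfl
  · simpa [abs_of_nonneg (hf y).1] using (hf y).2
  · simpa using hf₀ hy

theorem ProdIncludesCanonically.hasGluings (hUo : ∀ k, IsOpen (U k))
    (H : ProdIncludesCanonically U) :
    HasGluings U := by
  obtain ⟨φ, -, hφ, I, hI⟩ := H
  have hsingle (j : ℕ) (v : C0 (U j)) : φ (lp.single ∞ j v) = v := by
    have hk (k : ℕ) (hk : k ≠ j) : lp.single (E := fun k => C0 (U k)) ∞ j v k = 0 :=
      lp.single_apply_ne _ _ _ hk
    refine (hφ (lp.single ∞ j v) ?_).unique ?_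
    · refine tendsto_const_nhds.congr' ?_
      filter_upwards [Filter.eventually_gt_atTop j] with k hjk
      rw [hk k hjk.ne', norm_zero]
    · convert hasSum_single j fun k hkj => ?_ using 1
      · rw [lp.single_apply_self]
      · rw [hk k hkj]; rfl
  -- multiplying by functions in `C₀(Uⱼ)` determines `φ a` on `Uⱼ`
  have heq (a : C0Prod U) (j : ℕ) (x : X) (hx : x ∈ U j) : φ a x = (a j : C(X, ℂ)) x := by
    obtain ⟨v, hvx, -, hv⟩ := exists_bump (hUo j) hx
    have h : a * lp.single ∞ j ⟨v, hv⟩ = lp.single ∞ j (a j * ⟨v, hv⟩) := by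
      refine lp.ext (funext fun k => ?_)
      rw [lp.infty_coeFn_mul, Pi.mul_apply]
      by_cases hk : k = j
      · subst hk; simp only [lp.single_apply_self]
      · rw [lp.single_apply_ne _ _ _ hk, lp.single_apply_ne _ _ _ hk, mul_zero]
    have h' := congrArg (· x) (congrArg φ h)
    rw [map_mul, hsingle, hsingle] at h'
    simpa [hvx] using h'
  intro g R hg hR
  refine ⟨φ (C0Prod.mk g R hg hR), fun k x hx => heq _ k x hx, fun x hx => ?_⟩
  obtain ⟨v, hvx, -, hv⟩ := exists_bump isClosed_closure.isOpen_compl hx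
  -- as the range is an ideal, it contains `v * φ g`, which comes from a sequence vanishing on `U`
  have hmem : v * φ (C0Prod.mk g R hg hR) ∈ I :=
    I.mul_mem_left v (by rw [← SetLike.mem_coe, hI]; exact ⟨_, rfl⟩)
  rw [← SetLike.mem_coe, hI] at hmem
  obtain ⟨h, hh⟩ := hmem
  have h0 : h = 0 := C0Prod.ext fun k y hy => by
    rw [← heq h k y hy, hh, ContinuousMap.mul_apply,
      hv y fun hy' => hy' (subset_closure (Set.mem_iUnion_of_mem k hy)), zero_mul]
    rfl
  have h' := congrArg (· x) hh
  simpa [h0, hvx] using h'.symm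

end Gluing

/-! ### Small tails on a dense open set -/

section Tails

variable {X : Type*} [TopologicalSpace X]

theorem sum_star_mul_self_apply (s : Finset ℕ) (c : ℕ → C(X, ℂ)) (x : X) :
    (∑ k ∈ s, star (c k) * c k) x = ((∑ k ∈ s, ‖c k x‖ ^ 2 : ℝ) : ℂ) := by
  rw [ContinuousMap.sum_apply, Complex.ofReal_sum]
  refine Finset.sum_congr rfl fun k _ => ?_
  simpa using Complex.conj_mul' (c k x)

theorem norm_sum_star_mul_self_le_iff [CompactSpace X] {s : Finset ℕ} {c : ℕ → C(X, ℂ)} {C : ℝ}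
    (hC : 0 ≤ C) :
    ‖∑ k ∈ s, star (c k) * c k‖ ≤ C ↔ ∀ x, ∑ k ∈ s, ‖c k x‖ ^ 2 ≤ C := by
  rw [ContinuousMap.norm_le _ hC]
  refine forall_congr' fun x => ?_
  rw [sum_star_mul_self_apply, Complex.norm_real, Real.norm_of_nonneg (by positivity)]

/-- The points at which the tail `∑ k ≥ n, ‖c k x‖ ^ 2` is at most `ε`. -/
def smallTail (c : ℕ → C(X, ℂ)) (ε : ℝ) (n : ℕ) : Set X :=
  {x | ∀ s : Finset ℕ, Disjoint s (Finset.range n) → ∑ k ∈ s, ‖c k x‖ ^ 2 ≤ ε}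

/-- If the partial sums of `∑ k, ‖c k x‖ ^ 2` are bounded, the tails are locally uniformly small
near the points of a dense set. This is the Baire category theorem, as the closed sets `smallTail`
cover `X`. -/
theorem dense_iUnion_interior_smallTail [CompactSpace X] [T2Space X] {c : ℕ → C(X, ℂ)} {C : ℝ}
    (hc : ∀ s x, ∑ k ∈ s, ‖c k x‖ ^ 2 ≤ C) {ε : ℝ} (hε : 0 < ε) :
    Dense (⋃ n, interior (smallTail c ε n)) := by
  refine dense_iUnion_interior_of_closed (fun n => ?_) (Set.eq_univ_of_forall fun x => ?_)
  · simp only [smallTail, Set.ofPred_forall]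
    exact isClosed_iInter fun s => isClosed_iInter fun _ =>
      isClosed_le (by fun_prop) continuous_const
  · have hs : Summable fun k => ‖c k x‖ ^ 2 :=
      summable_of_sum_le (fun k => by positivity) fun s => hc s x
    obtain ⟨s, hs⟩ := summable_iff_vanishing_norm.1 hs ε hε
    refine Set.mem_iUnion.2 ⟨s.sup id + 1, fun t ht => ?_⟩
    refine (Real.le_norm_self _).trans (hs t (Finset.disjoint_left.2 fun k hkt hks => ?_)).le
    exact Finset.disjoint_left.1 ht hkt
      (Finset.mem_range.2 (Nat.lt_succ_of_le (Finset.le_sup (f := id) hks)))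

variable [CompactSpace X] [T2Space X]

/-- An element of the second dual module of `l₂(C(X))` is determined by its values at the coordinate
functionals: near a point where the coefficients of `f` have a small tail, `f` can be cut off to a
functional that is close in norm to a finite combination of coordinate functionals. -/
theorem bidual_eq_zero_of_coord {G : Dual C(X, ℂ) (Dual C(X, ℂ) (L2 C(X, ℂ)))}
    (hG : ∀ k, G.1 (Dual.coord C(X, ℂ) k) = 0) : G = 0 := by
  refine Subtype.ext (ContinuousLinearMap.ext fun f => ContinuousMap.ext fun x => ?_)
  have hle : ∀ ε > 0, ‖G.1 f x‖ ≤ ‖G‖ * ε := by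
    intro ε hε
    have hcl : IsClosed {x | ‖G.1 f x‖ ≤ ‖G‖ * ε} := isClosed_le (by fun_prop) continuous_const
    refine hcl.closure_subset_iff.2 ?_ (dense_iUnion_interior_smallTail (c := f.coeff)
      (fun s => (norm_sum_star_mul_self_le_iff (by positivity)).1 (f.norm_sum_coeff_le s))
      (pow_pos hε 2) x)
    intro y hy
    obtain ⟨n, hn⟩ := Set.mem_iUnion.1 hy
    obtain ⟨a, hay, ha₁, ha₀⟩ := exists_bump isOpen_interior hn
    let f' := a • (f - ∑ k ∈ Finset.range n, f.coeff k • Dual.coord C(X, ℂ) k)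
    have hcoeff (k : ℕ) : f'.coeff k = if k ∈ Finset.range n then 0 else a * f.coeff k := by
      rw [Dual.coeff_smul, Dual.coeff_sub, Dual.coeff_sum_smul_coord]
      split_ifs <;> simp
    have hf' : ‖f'‖ ≤ ε := by
      refine Dual.norm_le_of_sum_coeff_le hε.le fun s =>
        (norm_sum_star_mul_self_le_iff (by positivity)).2 fun z => ?_
      have hz (k : ℕ) : ‖f'.coeff k z‖ ^ 2 =
          if k ∉ Finset.range n then ‖a z * f.coeff k z‖ ^ 2 else 0 := by
        rw [hcoeff]
        split_ifs <;> simp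
      simp only [hz, ← Finset.sum_filter]
      by_cases hzn : z ∈ interior (smallTail f.coeff (ε ^ 2) n)
      · refine (Finset.sum_le_sum fun k _ => ?_).trans (interior_subset hzn
          (s.filter fun k => k ∉ Finset.range n)
          (Finset.disjoint_left.2 fun k hk => (Finset.mem_filter.1 hk).2))
        rw [norm_mul]
        gcongr
        exact mul_le_of_le_one_left (norm_nonneg _) (ha₁ z)
      · simp only [ha₀ z hzn, zero_mul, norm_zero]
        simpa using by positivity
    have hGf : G.1 f' = a * G.1 f := by
      rw [Dual.map_smul, map_sub, map_sum, Finset.sum_eq_zero fun k _ => ?_, sub_zero]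
      rw [Dual.map_smul, hG, mul_zero]
    calc ‖G.1 f y‖ = ‖G.1 f' y‖ := by rw [hGf, ContinuousMap.mul_apply, hay, one_mul]
      _ ≤ ‖G.1 f'‖ := (G.1 f').norm_coe_le_norm y
      _ ≤ ‖G‖ * ‖f'‖ := G.1.le_opNorm f'
      _ ≤ ‖G‖ * ε := by gcongr
  have hlim : Filter.Tendsto (fun ε : ℝ => ‖G‖ * ε) (𝓝[>] 0) (𝓝 0) := by
    have : Filter.Tendsto (fun ε : ℝ => ‖G‖ * ε) (𝓝 0) (𝓝 (‖G‖ * 0)) :=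
      (continuous_const_mul ‖G‖).tendsto 0
    rw [mul_zero] at this
    exact this.mono_left nhdsWithin_le_nhds
  exact norm_le_zero_iff.1 (ge_of_tendsto hlim (by filter_upwards [self_mem_nhdsWithin] using hle))

/-- A sequence with bounded but not uniformly convergent square sums has finite blocks, arbitrarily
far out, whose square sums are bounded below on disjoint non-empty open sets. -/
theorem exists_disjoint_blocks {b : ℕ → C(X, ℂ)} {C : ℝ}
    (hC : ∀ s x, ∑ k ∈ s, ‖b k x‖ ^ 2 ≤ C) (hb : ¬ Summable fun k => star (b k) * b k) :
    ∃ (U : ℕ → Set X) (t : ℕ → Finset ℕ) (δ : ℝ), 0 < δ ∧ (∀ i, IsOpen (U i)) ∧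
      (∀ i, (U i).Nonempty) ∧ Pairwise (fun i j => Disjoint (U i) (U j)) ∧
      (∀ i, ∀ k ∈ t i, i ≤ k) ∧ ∀ i, ∀ x ∈ U i, δ < ∑ k ∈ t i, ‖b k x‖ ^ 2 := by
  rw [summable_iff_vanishing_norm] at hb
  push Not at hb
  obtain ⟨ε, hε, hb⟩ := hb
  choose t ht hεt using fun n => hb (Finset.range n)
  let W (n : ℕ) : Set X := {x | ε / 2 < ∑ k ∈ t n, ‖b k x‖ ^ 2}
  have hWo (n : ℕ) : IsOpen (W n) := isOpen_lt continuous_const (by fun_prop)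
  have hWn (n : ℕ) : (W n).Nonempty := by
    by_contra h
    refine absurd (hεt n) (not_le.2 (lt_of_le_of_lt ?_ (half_lt_self hε)))
    refine (norm_sum_star_mul_self_le_iff (half_pos hε).le).2 fun x => not_lt.1 fun hx => h ⟨x, hx⟩
  -- shrink each `W n` to an open set that misses all `W j` with `j` large
  have hV (n : ℕ) : ∃ m, (W n ∩ interior (smallTail b (ε / 2) m)).Nonempty := by
    obtain ⟨x, hx, hxm⟩ := (dense_iUnion_interior_smallTail hC (half_pos hε)).inter_open_nonempty
      (W n) (hWo n) (hWn n)
    obtain ⟨m, hm⟩ := Set.mem_iUnion.1 hxm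
    exact ⟨m, x, hx, hm⟩
  choose m hm using hV
  let j : ℕ → ℕ := Nat.rec 0 fun _ n => max (m n) (n + 1)
  have hj (i : ℕ) : j (i + 1) = max (m (j i)) (j i + 1) := rfl
  have hmono : StrictMono j := strictMono_nat_of_lt_succ fun i => by
    rw [hj]; exact lt_max_of_lt_right (Nat.lt_succ_self _)
  have hdisj (i i' : ℕ) (h : i < i') : Disjoint (interior (smallTail b (ε / 2) (m (j i))))
      (W (j i')) := by
    refine Set.disjoint_left.2 fun x hx hxW => not_le.2 hxW (interior_subset hx _ ?_)
    refine (ht (j i')).mono_right (Finset.range_subset_range.2 ?_)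
    exact (le_max_left _ _).trans ((hj i).symm.trans_le (hmono.monotone h))
  refine ⟨fun i => W (j i) ∩ interior (smallTail b (ε / 2) (m (j i))), fun i => t (j i), ε / 2,
    half_pos hε, fun i => (hWo _).inter isOpen_interior, fun i => hm _, fun i i' hne => ?_,
    fun i k hk => ?_, fun i x hx => hx.1⟩
  · rcases hne.lt_or_gt with h | h
    · exact (hdisj i i' h).mono Set.inter_subset_right Set.inter_subset_left
    · exact (hdisj i' i h).symm.mono Set.inter_subset_left Set.inter_subset_right
  · refine hmono.le_apply.trans (not_lt.1 fun h => ?_)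
    exact Finset.disjoint_left.1 (ht (j i)) hk (Finset.mem_range.2 h)

end Tails

/-! ### Functionals on the dual module and gluings -/

section Criterion

variable {X : Type*} [TopologicalSpace X] [CompactSpace X]

theorem evalBidual_injective :
    Function.Injective (evalBidual C(X, ℂ) : L2 C(X, ℂ) → _) := fun m n h =>
  L2.ext_apply fun k => by
    rw [← Dual.coord_apply k m, ← Dual.coord_apply k n, ← evalBidual_apply, h, evalBidual_apply]

variable [T2Space X]

/-- A bounded functional `F` on the dual module whose coordinates `bₖ` have square sums bounded below
on blocks `tᵢ` over disjoint open sets `Uᵢ` glues bounded sequences `gᵢ ∈ C₀(Uᵢ)`: evaluate `F` at the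
functional with the coefficients `star bₖ * gᵢ / ∑ l ∈ tᵢ, |b_l|²` over `Uᵢ` for `k ∈ tᵢ`. -/
theorem hasGluings_of_blocks (F : Dual C(X, ℂ) (Dual C(X, ℂ) (L2 C(X, ℂ))))
    {U : ℕ → Set X} {t : ℕ → Finset ℕ} {δ : ℝ} (hδ : 0 < δ) (hUo : ∀ i, IsOpen (U i))
    (hU : Pairwise fun i j => Disjoint (U i) (U j)) (ht : ∀ i, ∀ k ∈ t i, i ≤ k)
    (hb : ∀ i, ∀ x ∈ U i, δ < ∑ k ∈ t i, ‖F.1 (Dual.coord C(X, ℂ) k) x‖ ^ 2) :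
    HasGluings U := by
  set b := fun k => F.1 (Dual.coord C(X, ℂ) k)
  intro g R hg hR
  have hR₀ : 0 ≤ R := (norm_nonneg _).trans (hR 0)
  -- truncating the denominator at `δ` makes it invertible everywhere and does not change it on `U i`
  let p (i : ℕ) (x : X) : ℝ := max (∑ k ∈ t i, ‖b k x‖ ^ 2) δ
  have hp (i : ℕ) (x : X) : 0 < p i x := lt_max_of_lt_right hδ
  have hpU (i : ℕ) (x : X) (hx : x ∈ U i) : p i x = ∑ k ∈ t i, ‖b k x‖ ^ 2 :=
    max_eq_left (hb i x hx).le
  let q (i : ℕ) : C(X, ℂ) := ⟨fun x => ((p i x)⁻¹ : ℝ), Complex.continuous_ofReal.comp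
    ((by fun_prop : Continuous (p i)).inv₀ fun x => (hp i x).ne')⟩
  -- the blocks `t i` containing `k` have `i ≤ k`, so each coefficient is a finite sum
  let c (k : ℕ) : C(X, ℂ) :=
    ∑ i ∈ Finset.range (k + 1), if k ∈ t i then star (b k) * q i * g i else 0
  have hg₀ {x : X} {i j : ℕ} (hx : x ∈ U j) (hij : i ≠ j) : g i x = 0 :=
    hg i x fun hx' => Set.disjoint_left.1 (hU hij) hx' hx
  have hcU (k j : ℕ) (x : X) (hx : x ∈ U j) :
      c k x = if k ∈ t j then star (b k x) * q j x * g j x else 0 := by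
    rw [ContinuousMap.sum_apply, Finset.sum_eq_single j]
    · split_ifs <;> rfl
    · intro i _ hij
      split_ifs
      · simp [hg₀ hx hij]
      · rfl
    · intro hj
      rw [if_neg fun hk => hj (Finset.mem_range.2 (Nat.lt_succ_of_le (ht j k hk)))]
      rfl
  have hc₀ (k : ℕ) (x : X) (hx : x ∉ ⋃ i, U i) : c k x = 0 := by
    rw [ContinuousMap.sum_apply]
    refine Finset.sum_eq_zero fun i _ => ?_
    split_ifs
    · simp [hg i x fun hx' => hx (Set.mem_iUnion_of_mem i hx')]
    · rfl
  -- on `U j` the square sum of the coefficients is at most `‖g j x‖ ^ 2 / p j x ≤ R ^ 2 / δ`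
  have hbound (s : Finset ℕ) : ‖∑ k ∈ s, star (c k) * c k‖ ≤ (R / √δ) ^ 2 := by
    refine (norm_sum_star_mul_self_le_iff (by positivity)).2 fun x => ?_
    by_cases hx : x ∈ ⋃ i, U i
    · obtain ⟨j, hj⟩ := Set.mem_iUnion.1 hx
      have h₁ (k : ℕ) : ‖c k x‖ ^ 2 =
          if k ∈ t j then ‖b k x‖ ^ 2 * ((p j x)⁻¹ ^ 2 * ‖g j x‖ ^ 2) else 0 := by
        rw [hcU k j x hj]
        split_ifs
        · have : ‖q j x‖ = (p j x)⁻¹ :=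
            (Complex.norm_real _).trans (Real.norm_of_nonneg (inv_nonneg.2 (hp j x).le))
          rw [norm_mul, norm_mul, norm_star, this]
          ring
        · simp
      calc ∑ k ∈ s, ‖c k x‖ ^ 2
          = ∑ k ∈ s with k ∈ t j, ‖b k x‖ ^ 2 * ((p j x)⁻¹ ^ 2 * ‖g j x‖ ^ 2) := by
            simp only [h₁, Finset.sum_filter]
        _ ≤ ∑ k ∈ t j, ‖b k x‖ ^ 2 * ((p j x)⁻¹ ^ 2 * ‖g j x‖ ^ 2) :=
            Finset.sum_le_sum_of_subset_of_nonneg (fun k hk => (Finset.mem_filter.1 hk).2)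
              fun _ _ _ => by positivity
        _ = p j x * ((p j x)⁻¹ ^ 2 * ‖g j x‖ ^ 2) := by rw [← Finset.sum_mul, hpU j x hj]
        _ = (p j x)⁻¹ * ‖g j x‖ ^ 2 := by
            have := (hp j x).ne'
            field_simp
        _ ≤ δ⁻¹ * R ^ 2 := by
            gcongr
            · exact le_max_right _ _
            · exact ((g j).norm_coe_le_norm x).trans (hR j)
        _ = (R / √δ) ^ 2 := by rw [div_pow, Real.sq_sqrt hδ.le]; ring
    · simp only [hc₀ _ x hx, norm_zero]
      simpa using by positivity
  let f := Dual.ofCoeff c (R / √δ) (by positivity) hbound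
  have hf (k : ℕ) : f.coeff k = c k := Dual.coeff_ofCoeff _ _ _ _ k
  refine ⟨F.1 f, fun j x hx => ?_, fun x hx => ?_⟩
  · obtain ⟨v, hvx, -, hv⟩ := exists_bump (hUo j) hx
    have hvf : v • f = ∑ k ∈ t j, (v * (star (b k) * q j * g j)) • Dual.coord C(X, ℂ) k := by
      refine Dual.ext_coeff fun k => ContinuousMap.ext fun y => ?_
      rw [Dual.coeff_smul, hf, Dual.coeff_sum_smul_coord, ContinuousMap.mul_apply]
      by_cases hy : y ∈ U j
      · rw [hcU k j y hy]
        split_ifs <;> simp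
      · rw [hv y hy]
        split_ifs <;> simp [hv y hy]
    have h := congrArg (fun w => F.1 w x) hvf
    simp only [Dual.map_smul, map_sum, ContinuousMap.mul_apply, hvx, one_mul,
      ContinuousMap.sum_apply] at h
    rw [h]
    have hsum : ∑ k ∈ t j, star (b k x) * b k x = (p j x : ℂ) := by
      rw [hpU j x hx, ← sum_star_mul_self_apply, ContinuousMap.sum_apply]
      rfl
    have hpx : (p j x : ℂ) ≠ 0 := Complex.ofReal_ne_zero.2 (hp j x).ne'
    calc ∑ k ∈ t j, star (b k) x * q j x * g j x * b k x
        = (∑ k ∈ t j, star (b k x) * b k x) * (q j x * g j x) := by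
          rw [Finset.sum_mul]
          exact Finset.sum_congr rfl fun k _ => by rw [ContinuousMap.star_apply]; ring
      _ = g j x := by
          have : q j x = (p j x : ℂ)⁻¹ := Complex.ofReal_inv _
          rw [hsum, this, mul_inv_cancel_left₀ hpx]
  · obtain ⟨v, hvx, -, hv⟩ := exists_bump isClosed_closure.isOpen_compl hx
    have hvf : v • f = 0 := by
      refine Dual.ext_coeff fun k => ContinuousMap.ext fun y => ?_
      rw [Dual.coeff_smul, hf, ContinuousMap.mul_apply]
      by_cases hy : y ∈ ⋃ i, U i
      · rw [hv y fun hy' => hy' (subset_closure hy), zero_mul]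
        rfl
      · rw [hc₀ k y hy, mul_zero]
        rfl
    have h := congrArg (fun w => F.1 w x) hvf
    simpa [Dual.map_smul, hvx] using h

/-- The gluing of `(uₖ f(eₖ))`, where `uₖ` is a bump function supported in `Uₖ`, is a bounded
`A`-linear function of `f` that does not come from a vector: its coordinates `uₖ` have norm one. -/
theorem not_isCStarReflexive_of_hasGluings {U : ℕ → Set X} (hUo : ∀ k, IsOpen (U k))
    (hUn : ∀ k, (U k).Nonempty) (H : HasGluings U) :
    ¬ IsCStarReflexive C(X, ℂ) (L2 C(X, ℂ)) := by
  choose x hx using hUn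
  choose u hux hu₁ hu₀ using fun k => exists_bump (hUo k) (hx k)
  have hbound (f : Dual C(X, ℂ) (L2 C(X, ℂ))) (k : ℕ) : ‖u k * f.coeff k‖ ≤ ‖f‖ := by
    have h := f.norm_sum_coeff_le {k}
    rw [Finset.sum_singleton, CStarRing.norm_star_mul_self, ← sq] at h
    calc ‖u k * f.coeff k‖ ≤ ‖u k‖ * ‖f.coeff k‖ := norm_mul_le _ _
      _ ≤ 1 * ‖f‖ := by
        gcongr
        · exact (ContinuousMap.norm_le _ zero_le_one).2 (hu₁ k)
        · exact le_of_sq_le_sq h (norm_nonneg _)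
      _ = ‖f‖ := one_mul _
  choose c hc using fun f : Dual C(X, ℂ) (L2 C(X, ℂ)) => H (fun k => u k * f.coeff k) ‖f‖
    (fun k y hy => by simp [hu₀ k y hy]) (hbound f)
  have huniq {f : Dual C(X, ℂ) (L2 C(X, ℂ))} {g : ℕ → C(X, ℂ)} {d : C(X, ℂ)} (h : IsGluing U g d)
      (hg : ∀ k, u k * f.coeff k = g k) : c f = d := by
    have := hc f
    simp only [hg] at this
    exact this.unique h
  let F : Dual C(X, ℂ) (Dual C(X, ℂ) (L2 C(X, ℂ))) :=
    ⟨LinearMap.mkContinuous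
      { toFun := c
        map_add' f g := huniq ((hc f).add (hc g)) fun k => mul_add _ _ _
        map_smul' z f := huniq ((hc f).const_smul z) fun k =>
          mul_smul_comm z (u k) (f.coeff k) } 1 fun f =>
        ((hc f).norm_le (norm_nonneg f) (hbound f)).trans_eq (one_mul _).symm,
      fun a f => huniq ((hc f).const_mul a) fun k => mul_left_comm _ _ _⟩
  intro hrefl
  obtain ⟨m, hm⟩ := hrefl.2 F
  have hm₁ (k : ℕ) : m k (x k) = 1 := by
    have h : (evalBidual C(X, ℂ) m).1 (Dual.coord C(X, ℂ) k) = c (Dual.coord C(X, ℂ) k) := by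
      rw [hm]; rfl
    rw [evalBidual_apply, Dual.coord_apply] at h
    rw [h, (hc _).eq_on k _ (hx k), ContinuousMap.mul_apply, hux, Dual.coeff_coord, if_pos rfl,
      one_mul, ContinuousMap.one_apply]
  have hlim := (L2.summable_inner m m).tendsto_atTop_zero.norm
  rw [norm_zero] at hlim
  obtain ⟨k, hk⟩ := (hlim.eventually_lt_const one_pos).exists
  have h := (star (m k) * m k).norm_coe_le_norm (x k)
  rw [ContinuousMap.mul_apply, ContinuousMap.star_apply, hm₁] at h
  simp only [star_one, mul_one, norm_one] at h
  exact absurd hk (not_lt.2 h)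

/-- If `l₂(C(X))` is not reflexive, some functional on the dual module has coordinates that do not
form a vector of `l₂(C(X))`; its blocks provide the open sets. -/
theorem exists_hasGluings_of_not_isCStarReflexive
    (h : ¬ IsCStarReflexive C(X, ℂ) (L2 C(X, ℂ))) :
    ∃ U : ℕ → Set X, (∀ k, IsOpen (U k)) ∧ (∀ k, (U k).Nonempty) ∧
      Pairwise (fun j k => Disjoint (U j) (U k)) ∧ HasGluings U := by
  have hsurj : ¬ Function.Surjective (evalBidual C(X, ℂ) : L2 C(X, ℂ) → _) :=
    fun hs => h ⟨evalBidual_injective, hs⟩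
  rw [Function.Surjective] at hsurj
  push Not at hsurj
  obtain ⟨F, hF⟩ := hsurj
  have hb : ¬ Summable fun k =>
      star (F.1 (Dual.coord C(X, ℂ) k)) * F.1 (Dual.coord C(X, ℂ) k) := by
    intro hs
    let m : L2 C(X, ℂ) := ⟨fun k => F.1 (Dual.coord C(X, ℂ) k), hs⟩
    refine hF m (sub_eq_zero.1 (bidual_eq_zero_of_coord fun k => ?_))
    change (evalBidual C(X, ℂ) m).1 _ - F.1 _ = 0
    rw [evalBidual_apply, Dual.coord_apply]
    exact sub_self _
  obtain ⟨U, t, δ, hδ, hUo, hUn, hU, ht, hbU⟩ := exists_disjoint_blocks (fun s =>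
    (norm_sum_star_mul_self_le_iff (by positivity)).1 (norm_sum_bidual_coord_le F s)) hb
  exact ⟨U, hUo, hUn, hU, hasGluings_of_blocks F hδ hUo hU ht hbU⟩

end Criterion

end HilbertReflexive

end

theorem mainTheorem1 (X : Type*) [TopologicalSpace X] [CompactSpace X] [T2Space X] :
    ¬ HilbertReflexive.IsCStarReflexive C(X, ℂ) (HilbertReflexive.L2 C(X, ℂ)) ↔
      ∃ U : ℕ → Set X,
        (∀ k, IsOpen (U k)) ∧ (∀ k, (U k).Nonempty) ∧
        Pairwise (fun j k => Disjoint (U j) (U k)) ∧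
        HilbertReflexive.ProdIncludesCanonically U := by
  constructor
  · intro h
    obtain ⟨U, hUo, hUn, hU, H⟩ := HilbertReflexive.exists_hasGluings_of_not_isCStarReflexive h
    exact ⟨U, hUo, hUn, hU, H.prodIncludesCanonically hU⟩
  · rintro ⟨U, hUo, hUn, -, H⟩
    exact HilbertReflexive.not_isCStarReflexive_of_hasGluings hUo hUn (H.hasGluings hUo)
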